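/- Let $G$ be a countable (discrete) group acting on a standard Borel space $X$ with a probability measure $\mu$, such that the action is non-singular, i.e. each $g\in G$ acts by a measurable map under which preimages of $\mu$-null sets are $\mu$-null. Let $H\le G$ be a subgroup that is co-amenable in $G$, i.e. there is a $G$-invariant mean on $G/H$ (a positive, normalised, translation-invariant linear functional on $\ell^\infty(G/H)$). If the restricted action of $H$ on $(X,\mu)$ is Zimmer-amenable, then the action of $G$ on $(X,\mu)$ is Zimmer-amenable. Here a non-singular action of a countable group $\Gamma$ on $(X,\mu)$ is called Zimmer-amenable if the following holds for every separable (real) Banach space $E$. Let $\alpha:\Gamma\times X\to \mathrm{Iso}(E)$ be a cocycle into the group of linear isometric automorphisms of $E$, measurable for the strong operator topology, i.e. for all $g,h\in\Gamma$, $\alpha(gh,x)=\alpha(g,hx)\,\alpha(h,x)$ for almost every $x$; for $T\in\mathrm{Iso}(E)$ write $T^*f=f\circ T^{-1}$ for the contragredient isometry of the dual $E^*$. Let $(K_x)_{x\in X}$ be a field of non-empty convex weak-* compact subsets of the unit ball of $E^*$, which is measurable (the set $\{(x,f): f\in K_x\}$ is measurable in $X\times E^*$, where $E^*$ carries the weak-*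 Borel $\sigma$-algebra) and invariant: for every $g\in\Gamma$, $\alpha(g,x)^*K_x=K_{gx}$ for almost every $x$. Then there is a weak-* measurable map $s:X\to E^*$ such that $s(x)\in K_x$ for almost every $x$ and, for every $g\in\Gamma$, $s(gx)=\alpha(g,x)^*s(x)$ for almost every $x$. -/

import Mathlib

open scoped ENNReal

/-- An action of `G` on the measure space `(X, μ)` by measurable maps is non-singular if every group
element maps the measure class of `μ` to itself: preimages of null sets are null (for all `g`,
hence also for `g⁻¹`). -/
def IsNonsingularAction (G : Type*) {X : Type*} [Group G] [MulAction G X] [MeasurableSpace X]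
    (μ : MeasureTheory.Measure X) : Prop :=
  ∀ g : G, MeasureTheory.Measure.QuasiMeasurePreserving (fun x : X => g • x) μ μ

/-- The subgroup `H` is co-amenable in `G`: there is a `G`-invariant mean on `G ⧸ H`, that is, a
positive normalised linear functional on `ℓ^∞(G ⧸ H)` that is invariant under translations. -/
def IsCoamenable {G : Type*} [Group G] (H : Subgroup G) : Prop :=
  ∃ m : lp (fun _ : G ⧸ H => ℝ) ∞ →ₗ[ℝ] ℝ,
    (∀ f : lp (fun _ : G ⧸ H => ℝ) ∞, (∀ q, 0 ≤ f q) → 0 ≤ m f) ∧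
    (∀ f : lp (fun _ : G ⧸ H => ℝ) ∞, (∀ q, f q = 1) → m f = 1) ∧
    (∀ (g : G) (f f' : lp (fun _ : G ⧸ H => ℝ) ∞), (∀ q, f' q = f (g • q)) → m f' = m f)

/-- The contragredient `f ↦ f ∘ T⁻¹` on the dual of `E` of a linear isometry `T` of `E`. -/
noncomputable def contragredient {E : Type*} [NormedAddCommGroup E] [NormedSpace ℝ E]
    (T : E ≃ₗᵢ[ℝ] E) (f : WeakDual ℝ E) : WeakDual ℝ E :=
  StrongDual.toWeakDual ((WeakDual.toStrongDual f).comp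
    (T.symm.toContinuousLinearEquiv : E →L[ℝ] E))

/-- The data of an affine `G`-space over `(X, μ)` in Zimmer's sense, for a countable group `G`: a
measurable cocycle `G × X → Iso(E)`, and a measurable field of non-empty convex weak-* compact
subsets of the unit ball of `E*` that is invariant under the contragredient of the cocycle.
The identities are required up to null sets, for each (pair of) group elements. -/
structure AffineSpaceOver (G : Type*) {X : Type*} [Group G] [MulAction G X] [MeasurableSpace X]
    (μ : MeasureTheory.Measure X) (E : Type*) [NormedAddCommGroup E] [NormedSpace ℝ E] where
  /-- the cocycle -/
  cocycle : G → X → (E ≃ₗᵢ[ℝ] E)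
  /-- measurability for the strong operator topology on `Iso(E)` -/
  measurable_cocycle : ∀ (g : G) (v : E),
    MeasureTheory.StronglyMeasurable (fun x => cocycle g x v)
  cocycle_mul : ∀ g h : G, ∀ᵐ x ∂μ, cocycle (g * h) x = cocycle g (h • x) * cocycle h x
  /-- the field of convex compact sets -/
  fiber : X → Set (WeakDual ℝ E)
  fiber_nonempty : ∀ x, (fiber x).Nonempty
  fiber_convex : ∀ x, Convex ℝ (fiber x)
  fiber_compact : ∀ x, IsCompact (fiber x)
  fiber_subset_ball : ∀ x, ∀ f ∈ fiber x, ‖WeakDual.toStrongDual f‖ ≤ 1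
  /-- the field is measurable: its graph is measurable for the product of the `σ`-algebra of `X`
  and the weak-* Borel `σ`-algebra -/
  measurable_fiber : @MeasurableSet (X × WeakDual ℝ E)
    (MeasurableSpace.prod inferInstance (borel (WeakDual ℝ E)))
    {p : X × WeakDual ℝ E | p.2 ∈ fiber p.1}
  fiber_invariant : ∀ g : G, ∀ᵐ x ∂μ, contragredient (cocycle g x) '' fiber x = fiber (g • x)

/-- A fixed point in the space of (classes of) measurable sections of the field: a weak-* measurable
section that is equivariant for the contragredient of the cocycle, up to null sets. -/
def AffineSpaceOver.HasFixedPoint {G X : Type*} [Group G] [MulAction G X] [MeasurableSpace X]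
    {μ : MeasureTheory.Measure X} {E : Type*} [NormedAddCommGroup E] [NormedSpace ℝ E]
    (A : AffineSpaceOver G μ E) : Prop :=
  ∃ s : X → WeakDual ℝ E,
    (∀ v : E, Measurable (fun x => s x v)) ∧
    (∀ᵐ x ∂μ, s x ∈ A.fiber x) ∧
    (∀ g : G, ∀ᵐ x ∂μ, s (g • x) = contragredient (A.cocycle g x) (s x))

/-- Amenability in Zimmer's sense of the action of the countable group `G` on `(X, μ)`: every affine
`G`-space over `X`, over any separable Banach space, has a fixed point. Every separable Banach space
is isometrically isomorphic to a quotient of `ℓ¹(ℕ)`, so that `Type` exhausts all of them. -/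
def IsZimmerAmenable (G : Type*) {X : Type*} [Group G] [MulAction G X] [MeasurableSpace X]
    (μ : MeasureTheory.Measure X) : Prop :=
  ∀ (E : Type) [NormedAddCommGroup E] [NormedSpace ℝ E] [CompleteSpace E]
    [TopologicalSpace.SeparableSpace E] (A : AffineSpaceOver G μ E), A.HasFixedPoint

/-! Let `s` be an `H`-equivariant section. Its translate by `g` is again a section of the field and,
up to null sets, depends only on the coset `gH`. This gives countably many sections `t q`, indexed
by `G ⧸ H` and permuted by `G`; their average under the invariant mean is the fixed point.

A mean is only finitely additive, so a pointwise average over `q` need be neither measurable nor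
compatible with integration. The integrals are averaged instead: `S` is determined by `∫ S(F) = m(q
↦ ∫ t q (F))` for integrable `F : X → E`, a weak-* average in the dual of `L¹(X, E)`
(`IsMean.exists_average`). Since a mean never exceeds the supremum, Hahn–Banach puts `S x` in the
fibre. For equivariance, `G` must act on the test sections: by non-singularity, a Radon–Nikodym
density turns a test of `S (g • x)` into a test of `S`, and invariance of `m` finishes the proof. -/

/-- The value of a linear functional `m` on `ℓ^∞(ι)` at a function `f : ι → ℝ`, with the junk value
`0` if `f` is unbounded. -/
noncomputable def meanValue {ι : Type*} (m : lp (fun _ : ι => ℝ) ∞ →ₗ[ℝ] ℝ) (f : ι → ℝ) : ℝ :=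
  open Classical in if h : Memℓp f ∞ then m ⟨f, h⟩ else 0

/-- A mean on `ι`: a positive normalised linear functional on `ℓ^∞(ι)`. -/
structure IsMean {ι : Type*} (m : lp (fun _ : ι => ℝ) ∞ →ₗ[ℝ] ℝ) : Prop where
  nonneg : ∀ f : lp (fun _ : ι => ℝ) ∞, (∀ q, 0 ≤ f q) → 0 ≤ m f
  one : ∀ f : lp (fun _ : ι => ℝ) ∞, (∀ q, f q = 1) → m f = 1

/-! ### Means on bounded functions and weak averages in Hilbert spaces -/

section Mean

variable {ι : Type*} {m : lp (fun _ : ι => ℝ) ∞ →ₗ[ℝ] ℝ}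

theorem memℓp_top_of_abs_le {f : ι → ℝ} {C : ℝ} (h : ∀ i, |f i| ≤ C) : Memℓp f ∞ :=
  memℓp_infty ⟨C, by rintro _ ⟨i, rfl⟩; exact h i⟩

theorem meanValue_of_memℓp {f : ι → ℝ} (h : Memℓp f ∞) : meanValue m f = m ⟨f, h⟩ := by
  simp [meanValue, h]

theorem meanValue_add {f g : ι → ℝ} (hf : Memℓp f ∞) (hg : Memℓp g ∞) :
    meanValue m (fun i => f i + g i) = meanValue m f + meanValue m g := by
  have hfg : Memℓp (fun i => f i + g i) ∞ := hf.add hg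
  rw [meanValue_of_memℓp hf, meanValue_of_memℓp hg, meanValue_of_memℓp hfg, ← map_add]
  rfl

theorem meanValue_sub {f g : ι → ℝ} (hf : Memℓp f ∞) (hg : Memℓp g ∞) :
    meanValue m (fun i => f i - g i) = meanValue m f - meanValue m g := by
  have hfg : Memℓp (fun i => f i - g i) ∞ := hf.sub hg
  rw [meanValue_of_memℓp hf, meanValue_of_memℓp hg, meanValue_of_memℓp hfg, ← map_sub]
  rfl

theorem meanValue_const_mul {f : ι → ℝ} (hf : Memℓp f ∞) (c : ℝ) :
    meanValue m (fun i => c * f i) = c * meanValue m f := by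
  have hfg : Memℓp (fun i => c * f i) ∞ := hf.const_smul c
  rw [meanValue_of_memℓp hf, meanValue_of_memℓp hfg, ← smul_eq_mul, ← map_smul]
  rfl

namespace IsMean

theorem meanValue_nonneg (hm : IsMean m) {f : ι → ℝ} (hf : ∀ i, 0 ≤ f i) :
    0 ≤ meanValue m f := by
  by_cases h : Memℓp f ∞
  · rw [meanValue_of_memℓp h]
    exact hm.nonneg _ hf
  · simp [meanValue, h]

theorem meanValue_const (hm : IsMean m) (c : ℝ) : meanValue m (fun _ => c) = c := by
  have h1 : Memℓp (fun _ : ι => (1 : ℝ)) ∞ := memℓp_top_of_abs_le (C := 1) (by simp)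
  have := meanValue_const_mul (m := m) h1 c
  rw [meanValue_of_memℓp h1, hm.one _ (fun _ => rfl)] at this
  simpa using this

theorem meanValue_le (hm : IsMean m) {f : ι → ℝ} {c : ℝ} (hf : Memℓp f ∞) (h : ∀ i, f i ≤ c) :
    meanValue m f ≤ c := by
  have hc : Memℓp (fun _ : ι => c) ∞ := memℓp_top_of_abs_le (C := |c|) (by simp)
  have := hm.meanValue_nonneg (f := fun i => c - f i) (fun i => sub_nonneg.2 (h i))
  rw [meanValue_sub hc hf, hm.meanValue_const] at this
  linarith

theorem abs_meanValue_le (hm : IsMean m) {f : ι → ℝ} {C : ℝ} (h : ∀ i, |f i| ≤ C) :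
    |meanValue m f| ≤ C := by
  have hf := memℓp_top_of_abs_le h
  refine abs_le.2 ⟨?_, hm.meanValue_le hf fun i => (abs_le.1 (h i)).2⟩
  have h1 := hm.meanValue_le (f := fun i => (-1) * f i) (c := C) (hf.const_smul (-1 : ℝ))
    (fun i => by linarith [(abs_le.1 (h i)).1])
  rw [meanValue_const_mul hf] at h1
  linarith

/-- The average of a bounded family of vectors of a Hilbert space, in the weak sense. -/
theorem exists_inner_eq_meanValue (hm : IsMean m) {V : Type*} [NormedAddCommGroup V]
    [InnerProductSpace ℝ V] [CompleteSpace V] (u : ι → V) {C : ℝ} (hu : ∀ i, ‖u i‖ ≤ C) :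
    ∃ d : V, ∀ v : V, inner ℝ d v = meanValue m (fun i => inner ℝ (u i) v) := by
  have hb : ∀ v i, |inner ℝ (u i) v| ≤ C * ‖v‖ := fun v i =>
    (abs_real_inner_le_norm _ _).trans (mul_le_mul_of_nonneg_right (hu i) (norm_nonneg v))
  have hmem : ∀ v, Memℓp (fun i => inner ℝ (u i) v) ∞ := fun v => memℓp_top_of_abs_le (hb v)
  let L : V →ₗ[ℝ] ℝ :=
    { toFun := fun v => meanValue m (fun i => inner ℝ (u i) v)
      map_add' := fun v w => by
        simp only [inner_add_right]
        exact meanValue_add (hmem v) (hmem w)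
      map_smul' := fun c v => by
        simp only [inner_smul_right]
        exact meanValue_const_mul (hmem v) c }
  refine ⟨(InnerProductSpace.toDual ℝ V).symm
    (L.mkContinuous C fun v => hm.abs_meanValue_le (hb v)), fun v => ?_⟩
  rw [InnerProductSpace.toDual_symm_apply]
  rfl

end IsMean

end Mean

/-! ### Functionals on dense subgroups and weak-* separation -/

section FunctionalAnalysis

variable {E : Type*} [NormedAddCommGroup E] [NormedSpace ℝ E]

/-- An additive function on a dense subgroup of `E` that is bounded by the norm extends to a
functional of norm at most one. -/
theorem exists_weakDual_eqOn_addSubgroup {D : AddSubgroup E} (hD : Dense (D : Set E)) {f : E → ℝ}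
    (hadd : ∀ v ∈ D, ∀ w ∈ D, f (v + w) = f v + f w) (hf : ∀ v ∈ D, |f v| ≤ ‖v‖) :
    ∃ T : WeakDual ℝ E, (∀ v, |T v| ≤ ‖v‖) ∧ ∀ v ∈ D, T v = f v := by
  have hsub : ∀ v ∈ D, ∀ w ∈ D, f (v - w) = f v - f w := fun v hv w hw => by
    have := hadd (v - w) (D.sub_mem hv hw) w hw
    rw [sub_add_cancel] at this
    linarith
  have hlip : LipschitzOnWith 1 f (D : Set E) := by
    refine LipschitzOnWith.of_dist_le_mul fun v hv w hw => ?_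
    rw [Real.dist_eq, ← hsub v hv w hw, NNReal.coe_one, one_mul, dist_eq_norm]
    exact hf _ (D.sub_mem hv hw)
  -- A Lipschitz extension need not be additive a priori; density of `D` and continuity force it,
  -- and a continuous additive map is real-linear.
  obtain ⟨g, hg, hgf⟩ := hlip.extend_real
  have hgadd : ∀ v w, g (v + w) = g v + g w := by
    intro v w
    refine isClosed_property2 (e := ((↑) : D → E)) hD.denseRange_val
      (p := fun v w => g (v + w) = g v + g w) (isClosed_eq ?_ ?_) (fun a b => ?_) v w
    · exact hg.continuous.comp (continuous_fst.add continuous_snd)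
    · exact (hg.continuous.comp continuous_fst).add (hg.continuous.comp continuous_snd)
    · rw [← hgf a.2, ← hgf b.2, ← hgf (D.add_mem a.2 b.2)]
      exact hadd _ a.2 _ b.2
  refine ⟨StrongDual.toWeakDual
    ((AddMonoidHom.mk' g hgadd).toRealLinearMap hg.continuous), fun v => ?_,
    fun v hv => (hgf hv).symm⟩
  have h0 : g 0 = 0 := by simpa using hgadd 0 0
  have := hg.dist_le_mul v 0
  rwa [Real.dist_eq, h0, sub_zero, NNReal.coe_one, one_mul, dist_zero_right] at this

/-- A weak-* closed convex set contains the functionals that satisfy all inequalities, tested on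
vectors, that hold on the set. -/
theorem mem_of_forall_apply_le {K : Set (WeakDual ℝ E)} (hc : Convex ℝ K) (hK : IsClosed K)
    {T : WeakDual ℝ E} (h : ∀ (v : E) (c : ℝ), (∀ f ∈ K, f v ≤ c) → T v ≤ c) : T ∈ K := by
  have : LocallyConvexSpace ℝ (WeakDual ℝ E) := WeakBilin.locallyConvexSpace
  by_contra hT
  obtain ⟨φ, c, h1, h2⟩ := geometric_hahn_banach_closed_point hc hK hT
  -- Weak-* continuous functionals on the dual are evaluations at vectors of `E`.
  obtain ⟨v, rfl⟩ := LinearMap.dualEmbedding_surjective (topDualPairing ℝ E) φ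
  exact absurd (h v c fun f hf => (h1 f hf).le) (not_le.2 h2)

theorem weakDual_abs_apply_le {T : WeakDual ℝ E} (hT : ‖WeakDual.toStrongDual T‖ ≤ 1) (v : E) :
    |T v| ≤ ‖v‖ := by
  have := (WeakDual.toStrongDual T).le_of_opNorm_le hT v
  rwa [one_mul] at this

end FunctionalAnalysis

open MeasureTheory

/-! ### Averaging measurable sections of the dual ball -/

section Average

variable {ι : Type*} {m : lp (fun _ : ι => ℝ) ∞ →ₗ[ℝ] ℝ} {X : Type*} [MeasurableSpace X]
  {μ : Measure X} [IsFiniteMeasure μ]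

theorem abs_setIntegral_le_of_ae_abs_le {u : X → ℝ} {C : ℝ} (hC : ∀ᵐ x ∂μ, |u x| ≤ C)
    (s : Set X) : |∫ x in s, u x ∂μ| ≤ C * μ.real s := by
  rw [← Real.norm_eq_abs]
  exact norm_setIntegral_le_of_norm_le_const_ae (measure_lt_top μ s) (ae_restrict_of_ae hC)

/-- The average of a uniformly bounded family of functions, characterised by its integrals. -/
theorem IsMean.exists_setIntegral_eq_meanValue (hm : IsMean m) {u : ι → X → ℝ} {C : ℝ}
    (hC0 : 0 ≤ C) (hu : ∀ i, Measurable (u i)) (hC : ∀ i, ∀ᵐ x ∂μ, |u i x| ≤ C) :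
    ∃ d : X → ℝ, Measurable d ∧ Integrable d μ ∧ ∀ s, MeasurableSet s →
      ∫ x in s, d x ∂μ = meanValue m (fun i => ∫ x in s, u i x ∂μ) := by
  -- As `μ` is finite, bounded functions lie in `L²`, where Riesz representation supplies the
  -- average; indicators then recover the set integrals.
  have hmem : ∀ i, MemLp (u i) 2 μ := fun i =>
    MemLp.of_bound (hu i).aestronglyMeasurable C (hC i)
  obtain ⟨d, hd⟩ := hm.exists_inner_eq_meanValue (fun i => (hmem i).toLp)
    (C := (measureUnivNNReal μ : ℝ) ^ (2 : ℝ≥0∞).toReal⁻¹ * C) (fun i => by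
      refine Lp.norm_le_of_ae_bound hC0 ?_
      filter_upwards [(hmem i).coeFn_toLp, hC i] with x h1 h2
      rw [h1]
      exact h2)
  have hsm := Lp.stronglyMeasurable d
  refine ⟨d, hsm.measurable, (Lp.memLp d).integrable one_le_two, fun s hs => ?_⟩
  rw [← L2.inner_indicatorConstLp_one (𝕜 := ℝ) hs (measure_ne_top μ s), real_inner_comm, hd]
  congr 1
  ext i
  rw [real_inner_comm, L2.inner_indicatorConstLp_one]
  exact integral_congr_ae (ae_restrict_of_ae (hmem i).coeFn_toLp)

variable {E : Type*} [NormedAddCommGroup E] [NormedSpace ℝ E]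

/-- Integer combinations of a dense sequence. With a countable subgroup, additivity amounts to
countably many almost sure identities, hence holds off one null set. -/
theorem exists_countable_dense_addSubgroup (E : Type*) [NormedAddCommGroup E]
    [TopologicalSpace.SeparableSpace E] :
    ∃ D : AddSubgroup E, (D : Set E).Countable ∧ Dense (D : Set E) := by
  let φ := Finsupp.linearCombination ℤ (TopologicalSpace.denseSeq E)
  refine ⟨φ.range.toAddSubgroup, ?_, (TopologicalSpace.denseRange_denseSeq E).mono ?_⟩
  · exact Set.countable_range φ
  · rintro _ ⟨n, rfl⟩
    exact ⟨Finsupp.single n 1, by simp [φ]⟩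

/-- Carathéodory's argument: `t x v` is continuous in `v` and measurable in `x`, hence jointly
measurable because `E` is separable. -/
theorem WeakDual.stronglyMeasurable_apply [TopologicalSpace.SeparableSpace E]
    {t : X → WeakDual ℝ E} (ht : ∀ v, Measurable fun x => t x v) {F : X → E}
    (hF : StronglyMeasurable F) : StronglyMeasurable fun x => t x (F x) := by
  borelize E
  have : SecondCountableTopology E := UniformSpace.secondCountable_of_separable E
  have h := stronglyMeasurable_uncurry_of_continuous_of_stronglyMeasurable
    (u := fun (v : E) x => t x v) (fun x => (t x).continuous)
    (fun v => (ht v).stronglyMeasurable)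
  exact h.comp_measurable (hF.measurable.prodMk measurable_id)

omit [IsFiniteMeasure μ] in
theorem WeakDual.integrable_apply [TopologicalSpace.SeparableSpace E]
    {t : X → WeakDual ℝ E} (ht : ∀ v, Measurable fun x => t x v)
    (hb : ∀ᵐ x ∂μ, ∀ v, |t x v| ≤ ‖v‖) {F : X → E} (hF : Integrable F μ) :
    Integrable (fun x => t x (F x)) μ := by
  obtain ⟨F', hF', hFF'⟩ := hF.aestronglyMeasurable
  refine hF.mono ⟨_, WeakDual.stronglyMeasurable_apply ht hF', ?_⟩ (hb.mono fun x hx => hx _)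
  exact hFF'.mono fun x hx => by simp only [hx]

omit [IsFiniteMeasure μ] in
theorem WeakDual.abs_integral_apply_le [TopologicalSpace.SeparableSpace E]
    {t : X → WeakDual ℝ E} (hb : ∀ᵐ x ∂μ, ∀ v, |t x v| ≤ ‖v‖) {F : X → E} (hF : Integrable F μ) :
    |∫ x, t x (F x) ∂μ| ≤ ∫ x, ‖F x‖ ∂μ := by
  rw [← Real.norm_eq_abs]
  exact norm_integral_le_of_norm_le hF.norm (hb.mono fun x hx => hx _)

omit [IsFiniteMeasure μ] in
/-- If `S` is the average of the sections `t i` when tested against constant sections on measurable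
sets, then it is the average of the `t i` when tested against all integrable sections. -/
theorem IsMean.integral_apply_eq_meanValue (hm : IsMean m) [TopologicalSpace.SeparableSpace E]
    {t : ι → X → WeakDual ℝ E} (ht : ∀ i v, Measurable fun x => t i x v)
    (hb : ∀ᵐ x ∂μ, ∀ i v, |t i x v| ≤ ‖v‖)
    {S : X → WeakDual ℝ E} (hS : ∀ v, Measurable fun x => S x v)
    (hSb : ∀ᵐ x ∂μ, ∀ v, |S x v| ≤ ‖v‖)
    (h : ∀ v s, MeasurableSet s →
      ∫ x in s, S x v ∂μ = meanValue m (fun i => ∫ x in s, t i x v ∂μ))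
    {F : X → E} (hF : Integrable F μ) :
    ∫ x, S x (F x) ∂μ = meanValue m (fun i => ∫ x, t i x (F x) ∂μ) := by
  have hb' : ∀ i, ∀ᵐ x ∂μ, ∀ v, |t i x v| ≤ ‖v‖ := fun i => hb.mono fun x hx => hx i
  have hmem : ∀ {F : X → E}, Integrable F μ → Memℓp (fun i => ∫ x, t i x (F x) ∂μ) ∞ :=
    fun hF => memℓp_top_of_abs_le fun i => WeakDual.abs_integral_apply_le (hb' i) hF
  let Λ : (X → E) → ℝ := fun F =>
    ∫ x, S x (F x) ∂μ - meanValue m (fun i => ∫ x, t i x (F x) ∂μ)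
  have hsub : ∀ {F F' : X → E}, Integrable F μ → Integrable F' μ → Λ F - Λ F' = Λ (F - F') := by
    intro F F' hF hF'
    have h1 : ∫ x, S x ((F - F') x) ∂μ = ∫ x, S x (F x) ∂μ - ∫ x, S x (F' x) ∂μ := by
      simp only [Pi.sub_apply, map_sub]
      exact integral_sub (WeakDual.integrable_apply hS hSb hF)
        (WeakDual.integrable_apply hS hSb hF')
    have h2 : ∀ i, ∫ x, t i x ((F - F') x) ∂μ = ∫ x, t i x (F x) ∂μ - ∫ x, t i x (F' x) ∂μ := by
      intro i
      simp only [Pi.sub_apply, map_sub]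
      exact integral_sub (WeakDual.integrable_apply (ht i) (hb' i) hF)
        (WeakDual.integrable_apply (ht i) (hb' i) hF')
    simp only [Λ, h1, h2, meanValue_sub (hmem hF) (hmem hF')]
    ring
  have hbound : ∀ {F : X → E}, Integrable F μ → |Λ F| ≤ 2 * ∫ x, ‖F x‖ ∂μ := by
    intro F hF
    have h1 := WeakDual.abs_integral_apply_le hSb hF
    have h2 := hm.abs_meanValue_le fun i => WeakDual.abs_integral_apply_le (hb' i) hF
    calc |Λ F| ≤ _ := abs_sub _ _
      _ ≤ _ := by linarith
  have hcongr : ∀ {F F' : X → E}, F =ᵐ[μ] F' → Λ F = Λ F' := by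
    intro F F' hFF'
    have h1 : ∀ t : X → WeakDual ℝ E, ∫ x, t x (F x) ∂μ = ∫ x, t x (F' x) ∂μ := fun t =>
      integral_congr_ae (hFF'.mono fun x hx => by simp only [hx])
    simp only [Λ, h1]
  suffices Λ F = 0 from sub_eq_zero.1 this
  -- `Λ` is additive and Lipschitz for the `L¹` norm, so vanishing on indicator sections suffices.
  refine Integrable.induction (fun F => Λ F = 0) ?_ ?_ ?_ ?_ hF
  · intro c s hs _
    have h1 : ∀ t : X → WeakDual ℝ E,
        ∫ x, t x (s.indicator (fun _ => c) x) ∂μ = ∫ x in s, t x c ∂μ := fun t => by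
      rw [← integral_indicator hs]
      congr 1
      ext x
      by_cases hx : x ∈ s <;> simp [hx]
    simp only [Λ, h1, h c s hs, sub_self]
  · intro f g _ hf hg hf0 hg0
    have := hsub (hf.add hg) hg
    rw [add_sub_cancel_right, hf0, hg0, sub_zero] at this
    exact this
  · have hcont : Continuous fun f : Lp E 1 μ => Λ f := by
      refine (LipschitzWith.of_dist_le_mul (K := 2) fun f g => ?_).continuous
      rw [Real.dist_eq, hsub (L1.integrable_coeFn f) (L1.integrable_coeFn g), dist_eq_norm,
        L1.norm_eq_integral_norm, ← hcongr (Lp.coeFn_sub f g)]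
      exact hbound (L1.integrable_coeFn _)
    exact isClosed_eq hcont continuous_const
  · intro f g hfg _ hf0
    rw [← hcongr hfg, hf0]

/-- The average of a countable family of measurable sections of the unit ball of the dual of a
separable Banach space: it lies almost everywhere in every weak-* closed convex set that contains
the values of all the sections. -/
theorem IsMean.exists_average [Countable ι] [Nonempty ι] (hm : IsMean m)
    [TopologicalSpace.SeparableSpace E]
    {t : ι → X → WeakDual ℝ E} (ht : ∀ i v, Measurable fun x => t i x v)
    (hb : ∀ᵐ x ∂μ, ∀ i v, |t i x v| ≤ ‖v‖) :
    ∃ S : X → WeakDual ℝ E, (∀ v, Measurable fun x => S x v) ∧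
      (∀ᵐ x ∂μ, ∀ v, |S x v| ≤ ‖v‖) ∧
      (∀ᵐ x ∂μ, ∀ K : Set (WeakDual ℝ E), Convex ℝ K → IsClosed K → (∀ i, t i x ∈ K) → S x ∈ K) ∧
      ∀ F : X → E, Integrable F μ →
        ∫ x, S x (F x) ∂μ = meanValue m (fun i => ∫ x, t i x (F x) ∂μ) := by
  obtain ⟨D, hDc, hD⟩ := exists_countable_dense_addSubgroup E
  have hDc' := hDc.to_subtype
  have hb' : ∀ i, ∀ᵐ x ∂μ, ∀ v, |t i x v| ≤ ‖v‖ := fun i => hb.mono fun x hx => hx i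
  choose d hdm hdi hd using fun v : E => hm.exists_setIntegral_eq_meanValue (μ := μ)
    (u := fun i x => t i x v) (norm_nonneg v) (fun i => ht i v)
    (fun i => (hb' i).mono fun x hx => hx v)
  have hti : ∀ i v s, IntegrableOn (fun x => t i x v) s μ := fun i v s =>
    (WeakDual.integrable_apply (ht i) (hb' i) (integrable_const v)).integrableOn
  have hmem : ∀ v s, Memℓp (fun i => ∫ x in s, t i x v ∂μ) ∞ := fun v s =>
    memℓp_top_of_abs_le fun i =>
      abs_setIntegral_le_of_ae_abs_le ((hb' i).mono fun x hx => hx v) s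
  have hdadd : ∀ v w, ∀ᵐ x ∂μ, d (v + w) x = d v x + d w x := by
    intro v w
    refine Integrable.ae_eq_of_forall_setIntegral_eq _ _ (hdi _) ((hdi v).add (hdi w)) ?_
    intro s hs _
    rw [hd _ s hs]
    simp only [map_add]
    rw [integral_add (hdi v).integrableOn (hdi w).integrableOn, hd v s hs, hd w s hs,
      ← meanValue_add (hmem v s) (hmem w s)]
    congr 1
    ext i
    exact integral_add (hti i v s) (hti i w s)
  have hdle : ∀ v (c : X → ℝ), Integrable c μ → (∀ i, ∀ᵐ x ∂μ, t i x v ≤ c x) →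
      ∀ᵐ x ∂μ, d v x ≤ c x := by
    intro v c hc hle
    refine ae_le_of_forall_setIntegral_le (hdi v) hc fun s hs _ => ?_
    rw [hd v s hs]
    exact hm.meanValue_le (hmem v s) fun i =>
      integral_mono_ae (hti i v s) hc.integrableOn (ae_restrict_of_ae (hle i))
  have hdb : ∀ v, ∀ᵐ x ∂μ, d v x ≤ ‖v‖ := fun v =>
    hdle v _ (integrable_const _) fun i => (hb' i).mono fun x hx => (le_abs_self _).trans (hx v)
  have hdbd : ∀ᵐ x ∂μ, ∀ v ∈ D, d v x ≤ ‖v‖ := (ae_ball_iff hDc).2 fun v _ => hdb v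
  -- The measurable conull set where `v ↦ d v x` extends from `D` to a functional of norm at most
  -- one; elsewhere `S x` is zero.
  let good : Set X := {x | (∀ v ∈ D, ∀ w ∈ D, d (v + w) x = d v x + d w x) ∧ ∀ v ∈ D, d v x ≤ ‖v‖}
  have hgeq : good = (⋂ v ∈ (D : Set E), ⋂ w ∈ (D : Set E), {x | d (v + w) x = d v x + d w x}) ∩
      ⋂ v ∈ (D : Set E), {x | d v x ≤ ‖v‖} := by
    ext x
    simp [good]
  have hgm : MeasurableSet good := by
    rw [hgeq]
    refine MeasurableSet.inter ?_ ?_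
    · refine MeasurableSet.biInter hDc fun v _ => MeasurableSet.biInter hDc fun w _ =>
        measurableSet_eq_fun (hdm _) ((hdm _).add (hdm _))
    · exact MeasurableSet.biInter hDc fun v _ => measurableSet_le (hdm _) measurable_const
  have hgood : ∀ᵐ x ∂μ, x ∈ good :=
    ((ae_ball_iff hDc).2 fun v _ => (ae_ball_iff hDc).2 fun w _ => hdadd v w).and hdbd
  have hext : ∀ x, ∃ T : WeakDual ℝ E, (∀ v, |T v| ≤ ‖v‖) ∧
      ∀ v ∈ D, T v = good.indicator (d v) x := by
    intro x
    by_cases hx : x ∈ good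
    · simp only [Set.indicator_of_mem hx]
      refine exists_weakDual_eqOn_addSubgroup hD hx.1 fun v hv => abs_le.2 ⟨?_, hx.2 v hv⟩
      have h0 := hx.1 0 D.zero_mem 0 D.zero_mem
      have h1 := hx.1 v hv (-v) (D.neg_mem hv)
      have h2 := hx.2 (-v) (D.neg_mem hv)
      rw [norm_neg] at h2
      rw [add_neg_cancel] at h1
      rw [add_zero] at h0
      linarith
    · exact ⟨0, fun v => (abs_zero (α := ℝ)).trans_le (norm_nonneg v),
        fun v _ => by rw [Set.indicator_of_notMem hx]; rfl⟩
  choose S hSb hS using hext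
  have hSm : ∀ v, Measurable fun x => S x v := by
    intro v
    obtain ⟨a, haD, hav⟩ := mem_closure_iff_seq_limit.1 (hD v)
    refine measurable_of_tendsto_metrizable (f := fun n x => S x (a n)) (fun n => ?_)
      (tendsto_pi_nhds.2 fun x => ((S x).continuous.tendsto v).comp hav)
    simp only [hS _ _ (haD n)]
    exact (hdm _).indicator hgm
  have hSd : ∀ᵐ x ∂μ, ∀ v ∈ D, S x v = d v x := hgood.mono fun x hx v hv => by
    rw [hS x v hv, Set.indicator_of_mem hx]
  have hSi : ∀ v s, MeasurableSet s →
      ∫ x in s, S x v ∂μ = meanValue m (fun i => ∫ x in s, t i x v ∂μ) := by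
    intro v s hs
    rw [← hd v s hs]
    -- `S x v` agrees with `d v x` by construction only for `v ∈ D`; a general `v` is approximated
    -- by `w ∈ D`, with a null set depending on `v` alone.
    have h1 : ∀ᵐ x ∂μ, ∀ w ∈ D, d v x = d w x + d (v - w) x ∧ d (v - w) x ≤ ‖v - w‖ ∧
        d w x = d v x + d (w - v) x ∧ d (w - v) x ≤ ‖w - v‖ := by
      refine (ae_ball_iff hDc).2 fun w _ => ?_
      have h2 := hdadd w (v - w)
      have h3 := hdadd v (w - v)
      rw [add_sub_cancel] at h2 h3
      exact h2.and ((hdb _).and (h3.and (hdb _)))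
    refine integral_congr_ae (ae_restrict_of_ae ?_)
    filter_upwards [h1, hSd] with x hx hxS
    refine eq_of_forall_dist_le fun ε hε => ?_
    obtain ⟨w, hw, hvw⟩ := hD.exists_dist_lt v (half_pos hε)
    rw [dist_eq_norm] at hvw
    obtain ⟨h2, h3, h4, h5⟩ := hx w hw
    have h6 := abs_le.1 (hSb x (v - w))
    rw [map_sub, hxS w hw] at h6
    rw [norm_sub_rev] at h5
    exact abs_le.2 ⟨by linarith [h6.1], by linarith [h6.2]⟩
  -- Countability of `ι` makes the supremum measurable. These inequalities on `D` handle all closed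
  -- convex `K` off a single null set, so `K` may depend on `x`.
  have hSsup : ∀ᵐ x ∂μ, ∀ v ∈ D, S x v ≤ ⨆ i, t i x v := by
    have hsup : ∀ᵐ x ∂μ, ∀ v ∈ D, d v x ≤ ⨆ i, t i x v := by
      refine (ae_ball_iff hDc).2 fun v _ => hdle v _ ?_ fun i => ?_
      · refine Integrable.of_bound (Measurable.iSup fun i => ht i v).aestronglyMeasurable ‖v‖ ?_
        filter_upwards [hb] with x hx
        have i := Classical.arbitrary ι
        refine abs_le.2 ⟨(abs_le.1 (hx i v)).1.trans ?_, ciSup_le fun i => (abs_le.1 (hx i v)).2⟩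
        exact le_ciSup (f := fun i => t i x v)
          ⟨‖v‖, by rintro _ ⟨j, rfl⟩; exact (abs_le.1 (hx j v)).2⟩ i
      · filter_upwards [hb] with x hx
        exact le_ciSup (f := fun i => t i x v)
          ⟨‖v‖, by rintro _ ⟨j, rfl⟩; exact (abs_le.1 (hx j v)).2⟩ i
    filter_upwards [hsup, hSd] with x h1 h2 v hv
    rw [h2 v hv]
    exact h1 v hv
  refine ⟨S, hSm, .of_forall hSb, ?_, fun F hF =>
    hm.integral_apply_eq_meanValue ht hb hSm (.of_forall hSb) hSi hF⟩
  filter_upwards [hSsup, hb] with x hx hbx K hKc hK hKt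
  refine mem_of_forall_apply_le hKc hK fun v c hvc => le_of_forall_pos_le_add fun ε hε => ?_
  obtain ⟨w, hw, hvw⟩ := hD.exists_dist_lt v (half_pos hε)
  rw [dist_eq_norm] at hvw
  have h1 : (⨆ i, t i x w) ≤ c + ε / 2 := by
    refine ciSup_le fun i => ?_
    have h2 := (abs_le.1 (hbx i (v - w))).1
    rw [map_sub] at h2
    linarith [hvc _ (hKt i)]
  have h3 := (abs_le.1 (hSb x (v - w))).2
  rw [map_sub] at h3
  linarith [hx w hw]

end Average


/-! ### Translates of sections and change of variables -/

section AffineSpace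

variable {G X : Type*} [Group G] [MulAction G X] [MeasurableSpace X] {μ : Measure X}
  {E : Type*} [NormedAddCommGroup E] [NormedSpace ℝ E]

@[simp]
theorem contragredient_apply (T : E ≃ₗᵢ[ℝ] E) (f : WeakDual ℝ E) (v : E) :
    contragredient T f v = f (T.symm v) := rfl

namespace AffineSpaceOver

/-- The restriction of an affine space over `X` to a subgroup. -/
def restrict (A : AffineSpaceOver G μ E) (H : Subgroup G) : AffineSpaceOver H μ E where
  cocycle h := A.cocycle h
  measurable_cocycle h := A.measurable_cocycle h
  cocycle_mul g h := A.cocycle_mul g h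
  fiber := A.fiber
  fiber_nonempty := A.fiber_nonempty
  fiber_convex := A.fiber_convex
  fiber_compact := A.fiber_compact
  fiber_subset_ball := A.fiber_subset_ball
  measurable_fiber := A.measurable_fiber
  fiber_invariant h := A.fiber_invariant h

/-- The translate of a section by a group element. -/
noncomputable def translate (A : AffineSpaceOver G μ E) (s : X → WeakDual ℝ E) (g : G) (x : X) :
    WeakDual ℝ E :=
  StrongDual.toWeakDual ((WeakDual.toStrongDual (s (g⁻¹ • x))).comp
    ((A.cocycle g⁻¹ x).toContinuousLinearEquiv : E →L[ℝ] E))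

variable (A : AffineSpaceOver G μ E) {s : X → WeakDual ℝ E}

@[simp]
theorem translate_apply (g : G) (x : X) (v : E) :
    A.translate s g x v = s (g⁻¹ • x) (A.cocycle g⁻¹ x v) := rfl

theorem measurable_translate [TopologicalSpace.SeparableSpace E] (hG : IsNonsingularAction G μ)
    (hs : ∀ v, Measurable fun x => s x v) (g : G) (v : E) :
    Measurable fun x => A.translate s g x v :=
  (WeakDual.stronglyMeasurable_apply (t := fun x => s (g⁻¹ • x))
    (fun v => (hs v).comp (hG g⁻¹).measurable) (A.measurable_cocycle g⁻¹ v)).measurable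

/-- Invariance of the field under `g⁻¹` identifies the fibre at `g⁻¹ • x` with the one at `x`;
non-singularity keeps the exceptional set null. -/
theorem translate_mem_fiber (hG : IsNonsingularAction G μ) (hs : ∀ᵐ x ∂μ, s x ∈ A.fiber x)
    (g : G) : ∀ᵐ x ∂μ, A.translate s g x ∈ A.fiber x := by
  filter_upwards [A.fiber_invariant g⁻¹, (hG g⁻¹).ae hs] with x h1 h2
  rw [← h1] at h2
  obtain ⟨f, hf, hfs⟩ := h2
  convert hf
  refine DFunLike.ext _ _ fun v => ?_
  rw [translate_apply, ← hfs, contragredient_apply, LinearIsometryEquiv.symm_apply_apply]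

/-- Translating a translate. -/
theorem translate_smul_apply_cocycle (g k : G) :
    ∀ᵐ x ∂μ, ∀ v, A.translate s k (g • x) (A.cocycle g x v) = A.translate s (g⁻¹ * k) x v := by
  filter_upwards [A.cocycle_mul k⁻¹ g] with x hx v
  simp only [translate_apply, mul_inv_rev, inv_inv, hx, mul_smul, LinearIsometryEquiv.coe_mul,
    Function.comp_apply]

/-- The translate of an `H`-equivariant section by `g` depends only on the coset `gH`. -/
theorem translate_mul_of_mem (hG : IsNonsingularAction G μ) {H : Subgroup G}
    (hs : ∀ h : H, ∀ᵐ x ∂μ, s (h • x) = contragredient (A.cocycle h x) (s x))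
    (g : G) (h : H) : ∀ᵐ x ∂μ, A.translate s (g * h) x = A.translate s g x := by
  filter_upwards [A.cocycle_mul (h : G)⁻¹ g⁻¹, (hG g⁻¹).ae (hs h⁻¹)] with x h1 h2
  refine DFunLike.ext _ _ fun v => ?_
  have h3 : ((h⁻¹ : H) : G) • g⁻¹ • x = (h⁻¹ : H) • g⁻¹ • x := rfl
  simp only [InvMemClass.coe_inv] at h2 h3
  simp only [translate_apply, mul_inv_rev, h1, mul_smul, LinearIsometryEquiv.coe_mul,
    Function.comp_apply, h3, h2, contragredient_apply, LinearIsometryEquiv.symm_apply_apply]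

end AffineSpaceOver

omit [NormedSpace ℝ E] in
/-- Two families of continuous functions on a separable space agree almost everywhere if, at every
point of the space, their integrals over measurable sets agree. -/
theorem ae_eq_of_forall_setIntegral_apply_eq [IsFiniteMeasure μ]
    [TopologicalSpace.SeparableSpace E] {f g : X → E → ℝ} (hfc : ∀ x, Continuous (f x))
    (hgc : ∀ x, Continuous (g x)) (hf : ∀ v, Integrable (fun x => f x v) μ)
    (hg : ∀ v, Integrable (fun x => g x v) μ)
    (h : ∀ v s, MeasurableSet s → ∫ x in s, f x v ∂μ = ∫ x in s, g x v ∂μ) :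
    ∀ᵐ x ∂μ, f x = g x := by
  obtain ⟨D, hDc, hD⟩ := TopologicalSpace.exists_countable_dense E
  have : ∀ᵐ x ∂μ, ∀ v ∈ D, f x v = g x v := (ae_ball_iff hDc).2 fun v _ =>
    Integrable.ae_eq_of_forall_setIntegral_eq _ _ (hf v) (hg v) fun s hs _ => h v s hs
  exact this.mono fun x hx => (hfc x).ext_on hD (hgc x) hx

/-- A change of variables for integrals along a non-singular action. -/
theorem IsNonsingularAction.integral_smul [IsFiniteMeasure μ] (hG : IsNonsingularAction G μ)
    (g : G) {F : X → E} (hF : StronglyMeasurable F) :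
    ∫ x, F (g • x) ∂μ =
      ∫ x, ((μ.map (g • ·)).rnDeriv μ x).toReal • F x ∂μ := by
  rw [integral_rnDeriv_smul (hG g).absolutelyContinuous,
    integral_map (hG g).measurable.aemeasurable hF.aestronglyMeasurable]

end AffineSpace

/-! ### The averaged section is a fixed point -/

theorem proposition2p3 {G X : Type*} [Group G] [Countable G] [MulAction G X]
    [MeasurableSpace X] [StandardBorelSpace X]
    (μ : MeasureTheory.Measure X) [MeasureTheory.IsProbabilityMeasure μ]
    (hG : IsNonsingularAction G μ)
    (H : Subgroup G) (hH : IsCoamenable H) (hHX : IsZimmerAmenable H μ) :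
    IsZimmerAmenable G μ := by
  intro E _ _ _ _ A
  obtain ⟨s, hsm, hsK, hsH⟩ := hHX E (A.restrict H)
  obtain ⟨m, hpos, hone, hinv⟩ := hH
  have hm : IsMean m := ⟨hpos, hone⟩
  have : Countable (G ⧸ H) := Quotient.countable
  let t : G ⧸ H → X → WeakDual ℝ E := fun q => A.translate s q.out
  have htm : ∀ q v, Measurable fun x => t q x v := fun q v => A.measurable_translate hG hsm _ v
  have htK : ∀ᵐ x ∂μ, ∀ q, t q x ∈ A.fiber x := ae_all_iff.2 fun q =>
    A.translate_mem_fiber hG hsK _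
  have htb : ∀ᵐ x ∂μ, ∀ q v, |t q x v| ≤ ‖v‖ := htK.mono fun x hx q v =>
    weakDual_abs_apply_le (A.fiber_subset_ball x _ (hx q)) v
  -- `G` permutes the sections `t q`: the representative of `g⁻¹ • q` differs from `g⁻¹ * q.out` by
  -- an element of `H`, which changes the translate only on a null set.
  have htg : ∀ (g : G) (q : G ⧸ H),
      ∀ᵐ x ∂μ, ∀ v, t q (g • x) (A.cocycle g x v) = t (g⁻¹ • q) x v := by
    intro g q
    obtain ⟨h, hh⟩ := QuotientGroup.mk_out_eq_mul H (g⁻¹ * q.out)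
    have hq : ((g⁻¹ * q.out : G) : G ⧸ H) = g⁻¹ • q := by
      conv_rhs => rw [← QuotientGroup.out_eq' q]
      rfl
    rw [hq] at hh
    filter_upwards [A.translate_smul_apply_cocycle (s := s) g q.out,
      A.translate_mul_of_mem hG hsH (g⁻¹ * q.out) h] with x h1 h2 v
    simp only [t, h1, hh, h2]
  obtain ⟨S, hSm, hSb, hSK, hS⟩ := hm.exists_average htm htb
  refine ⟨S, hSm, ?_, fun g => ?_⟩
  · filter_upwards [hSK, htK] with x hx hxt
    exact hx _ (A.fiber_convex x) (A.fiber_compact x).isClosed hxt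
  have hinv' : ∀ (f : G ⧸ H → ℝ), Memℓp f ∞ →
      meanValue m (fun q => f (g⁻¹ • q)) = meanValue m f := by
    intro f hf
    have hf' : Memℓp (fun q => f (g⁻¹ • q)) ∞ := by
      obtain ⟨C, hC⟩ := memℓp_infty_iff.1 hf
      exact memℓp_top_of_abs_le (C := C) fun q => hC ⟨_, rfl⟩
    rw [meanValue_of_memℓp hf, meanValue_of_memℓp hf']
    exact hinv g⁻¹ ⟨f, hf⟩ ⟨_, hf'⟩ fun _ => rfl
  have hSg : ∀ᵐ x ∂μ, ∀ v, |S (g • x) v| ≤ ‖v‖ := (hG g).ae hSb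
  have key : ∀ᵐ x ∂μ, (fun v => S (g • x) (A.cocycle g x v)) = fun v => S x v := by
    refine ae_eq_of_forall_setIntegral_apply_eq
      (fun x => (S (g • x)).continuous.comp (A.cocycle g x).continuous) (fun x => (S x).continuous)
      (fun v => ?_) (fun v => WeakDual.integrable_apply hSm hSb (integrable_const v))
      fun v B hB => ?_
    · refine WeakDual.integrable_apply (t := fun x => S (g • x))
        (fun v => (hSm v).comp (hG g).measurable) hSg ?_
      exact Integrable.of_bound (A.measurable_cocycle g v).aestronglyMeasurable ‖v‖
        (.of_forall fun x => by simp)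
    -- Chosen so that `F (g • x)` is `A.cocycle g x v` on `B` and zero off `B`.
    let F : X → E := fun y => ((g⁻¹ • ·) ⁻¹' B).indicator (fun y => A.cocycle g (g⁻¹ • y) v) y
    have hFm : StronglyMeasurable F :=
      ((A.measurable_cocycle g v).comp_measurable (hG g⁻¹).measurable).indicator
        ((hG g⁻¹).measurable hB)
    have hFg : ∀ x, F (g • x) = B.indicator (fun x => A.cocycle g x v) x := fun x => by
      have h1 : g • x ∈ (g⁻¹ • ·) ⁻¹' B ↔ x ∈ B := by
        rw [Set.mem_preimage, inv_smul_smul]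
      by_cases hx : x ∈ B
      · simp only [F, Set.indicator_of_mem (h1.2 hx), Set.indicator_of_mem hx, inv_smul_smul]
      · simp only [F, Set.indicator_of_notMem (mt h1.1 hx), Set.indicator_of_notMem hx]
    have hFb : ∀ y, ‖F y‖ ≤ ‖v‖ := fun y => by
      refine (norm_indicator_le_norm_self _ _).trans ?_
      simp
    let ρ : X → ℝ := fun x => ((μ.map (g • ·)).rnDeriv μ x).toReal
    have hFi : Integrable (fun y => ρ y • F y) μ := by
      refine (integrable_rnDeriv_smul_iff (hG g).absolutelyContinuous).2 ?_
      have := Measure.isFiniteMeasure_map μ (g • ·)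
      exact Integrable.of_bound hFm.aestronglyMeasurable ‖v‖ (.of_forall hFb)
    -- The test section `ρ • F` does not depend on `T`, so the same formula serves for `S` and for
    -- every `t q`.
    have hcv : ∀ T : X → WeakDual ℝ E, (∀ v, Measurable fun x => T x v) →
        ∫ x in B, T (g • x) (A.cocycle g x v) ∂μ = ∫ y, T y (ρ y • F y) ∂μ := by
      intro T hT
      simp only [map_smul]
      rw [← hG.integral_smul g (WeakDual.stronglyMeasurable_apply hT hFm), ← integral_indicator hB]
      congr 1
      ext x
      rw [hFg]
      by_cases hx : x ∈ B <;> simp [hx]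
    have hset : ∀ T : X → WeakDual ℝ E,
        ∫ x in B, T x v ∂μ = ∫ x, T x (B.indicator (fun _ => v) x) ∂μ := by
      intro T
      rw [← integral_indicator hB]
      congr 1
      ext x
      by_cases hx : x ∈ B <;> simp [hx]
    have hBi : Integrable (B.indicator fun _ => v) μ := (integrable_const v).indicator hB
    rw [hcv S hSm, hS _ hFi, hset, hS _ hBi,
      ← hinv' _ (memℓp_top_of_abs_le fun q =>
        WeakDual.abs_integral_apply_le (htb.mono fun x hx => hx q) hBi)]
    congr 1
    ext q
    rw [← hcv _ (htm q), ← hset]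
    exact integral_congr_ae (ae_restrict_of_ae ((htg g q).mono fun x hx => hx v))
  filter_upwards [key] with x hx
  refine DFunLike.ext _ _ fun v => ?_
  rw [contragredient_apply, ← congrFun hx, LinearIsometryEquiv.apply_symm_apply]
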